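/- Let $W$ denote the principal real branch of the Lambert function, i.e. the inverse of the bijection $w\mapsto we^{w}$ from $[-1,\infty)$ onto $[-1/e,\infty)$; in particular, for $x>0$, $W(x)>0$ is the unique positive number with $W(x)e^{W(x)}=x$. A function $f:(0,\infty)\to\mathbb{R}$ is called completely monotonic if it has derivatives of all orders and $(-1)^n f^{(n)}(x)\ge 0$ for all $x>0$ and $n=0,1,2,\dots$. Theorem. The following functions of $x>0$ are completely monotonic (all parameters are real): (a) $x^\lambda W(x)$, for $\lambda\le -1$; (b) $x^\lambda\, W(x^\beta)^{\alpha}\,[1+W(x^\beta)]^{\gamma}$, for $\alpha\ge 0$, $\gamma\ge 0$, $-1\le\beta\le 0$, $\lambda\le 0$; (c) $x^\lambda\, W(x^{-\beta})^{\alpha}\,[1+W(x^{-\beta})]^{\gamma}$, for $\alpha\le 0$, $\gamma\le 0$, $-1\le\beta\le 0$, $\lambda\le 0$; (d) $1-x^{-\alpha\beta\gamma}\, W(x^\beta)^{\alpha\gamma}\,[1+W(x^\beta)]^{\gamma-1}$, for $0\le\alpha\le 1$, $-1\le\beta\le 0$, $0\le\gamma\le 1$. -/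

import Mathlib

open Set
open scoped ContDiff

/-- The principal branch `W = W₀` of the Lambert function on the real line: the inverse of
`w ↦ w * exp w` restricted to `[-1, ∞)`. It is meaningful for `x ≥ -1/e`. -/
noncomputable def lambertW (x : ℝ) : ℝ :=
  Function.invFunOn (fun w : ℝ => w * Real.exp w) (Ici (-1)) x

theorem strictMonoOn_mul_exp : StrictMonoOn (fun w : ℝ => w * Real.exp w) (Ici (-1)) := by
  have hd : ∀ w : ℝ, HasDerivAt (fun w : ℝ => w * Real.exp w)
      (1 * Real.exp w + w * Real.exp w) w := fun w => (hasDerivAt_id w).mul (Real.hasDerivAt_exp w)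
  refine strictMonoOn_of_deriv_pos (convex_Ici _) (by fun_prop) fun w hw => ?_
  rw [interior_Ici, mem_Ioi] at hw
  rw [(hd w).deriv, ← add_mul]
  exact mul_pos (by linarith) (Real.exp_pos w)

/-- `W x` lies in `[-1, ∞)` and solves `W x * exp (W x) = x`, for every `x ≥ -1/e`. -/
theorem lambertW_spec {x : ℝ} (hx : -Real.exp (-1) ≤ x) :
    -1 ≤ lambertW x ∧ lambertW x * Real.exp (lambertW x) = x := by
  have hex : ∃ w ∈ Ici (-1 : ℝ), w * Real.exp w = x := by
    have hle : (-1 : ℝ) ≤ max 0 x := le_trans (by norm_num) (le_max_left 0 x)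
    have hc : ContinuousOn (fun w : ℝ => w * Real.exp w) (Icc (-1) (max 0 x)) := by fun_prop
    have hr : x ≤ max 0 x * Real.exp (max 0 x) :=
      (le_max_right 0 x).trans
        (le_mul_of_one_le_right (le_max_left 0 x) (Real.one_le_exp (le_max_left 0 x)))
    obtain ⟨w, hw, h⟩ := intermediate_value_Icc hle hc ⟨by simpa using hx, hr⟩
    exact ⟨w, hw.1, h⟩
  exact Function.invFunOn_pos hex

/-- `W` is a left inverse of `w ↦ w * exp w` on `[-1, ∞)`. -/
theorem lambertW_mul_exp {w : ℝ} (hw : -1 ≤ w) : lambertW (w * Real.exp w) = w :=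
  strictMonoOn_mul_exp.injOn.leftInvOn_invFunOn (mem_Ici.2 hw)

/-- `W x > 0` for `x > 0`. -/
theorem lambertW_pos {x : ℝ} (hx : 0 < x) : 0 < lambertW x := by
  have h := (lambertW_spec (x := x) (by linarith [Real.exp_pos (-1)])).2
  exact pos_of_mul_pos_left (h ▸ hx) (Real.exp_pos _).le

/-- `f` is completely monotonic on `(0, ∞)`: it has derivatives of all orders there, and
`(-1)^n * f^(n)(x) ≥ 0` for all `x > 0` and `n = 0, 1, 2, …`. Values of `f` outside `(0, ∞)`
play no role. -/
def IsCompletelyMonotonic (f : ℝ → ℝ) : Prop :=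
  ContDiffOn ℝ ∞ f (Ioi 0) ∧ ∀ n : ℕ, ∀ x : ℝ, 0 < x → 0 ≤ (-1 : ℝ) ^ n * iteratedDeriv n f x

/-! Both `W` and `V(x) = 1 / W(1/x)` (`invLambertWInv`) solve autonomous equations, `W' = exp(-W) /
(1 + W)` and `V' = exp(1/V) V / (1 + V)`, whose right-hand sides are completely monotonic (CM)
functions of the unknown. A bootstrap on the order (`IsBernstein.of_ode`) makes both solutions
Bernstein functions, and a CM function of a Bernstein function is CM (`AltMonoAll.comp`).

Every case then reduces to elementary functions: a power of `x` times a CM function of `W` or `V`,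
or, in the last family, a derivative that is minus a CM function of `V`. Since `0 ≤ -β ≤ 1`, `x ^
(-β)` is Bernstein and may be substituted. The elementary functions are mostly `exp(c/v) v^a
(1+v)^d`, which are CM as soon as their negative logarithmic derivative is. -/

/-- Complete monotonicity on `(0, ∞)` up to order `n`: `f ≥ 0`, and `-f'` is completely monotonic
up to order `n - 1`. -/
def AltMono : ℕ → (ℝ → ℝ) → Prop
  | 0, f => ∀ x : ℝ, 0 < x → 0 ≤ f x
  | n + 1, f => (∀ x : ℝ, 0 < x → 0 ≤ f x) ∧
      ∃ g : ℝ → ℝ, (∀ x : ℝ, 0 < x → HasDerivAt f (-g x) x) ∧ AltMono n g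

/-- Complete monotonicity up to every order. -/
def AltMonoAll (f : ℝ → ℝ) : Prop := ∀ n, AltMono n f

/-- A positive function on `(0, ∞)` with completely monotonic derivative `g'`. -/
structure IsBernstein (g g' : ℝ → ℝ) : Prop where
  pos : ∀ x : ℝ, 0 < x → 0 < g x
  hasDerivAt : ∀ x : ℝ, 0 < x → HasDerivAt g (g' x) x
  altMono : AltMonoAll g'

/-! ### Closure rules at finite order. -/

namespace AltMono

theorem nonneg {n : ℕ} {f : ℝ → ℝ} (h : AltMono n f) {x : ℝ} (hx : 0 < x) : 0 ≤ f x := by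
  cases n with
  | zero => exact h x hx
  | succ n => exact h.1 x hx

theorem congr {n : ℕ} {f g : ℝ → ℝ} (h : AltMono n f) (e : ∀ x : ℝ, 0 < x → g x = f x) :
    AltMono n g := by
  cases n with
  | zero => exact fun x hx => (e x hx).symm ▸ h x hx
  | succ n =>
    obtain ⟨h0, k, hk, hkn⟩ := h
    refine ⟨fun x hx => (e x hx).symm ▸ h0 x hx, k, fun x hx => ?_, hkn⟩
    exact (hk x hx).congr_of_eventuallyEq (Filter.eventuallyEq_of_mem (Ioi_mem_nhds hx) e)

theorem of_succ {n : ℕ} : ∀ {f : ℝ → ℝ}, AltMono (n + 1) f → AltMono n f := by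
  induction n with
  | zero => exact fun h => h.1
  | succ n ih =>
    rintro f ⟨h0, k, hk, hkn⟩
    exact ⟨h0, k, hk, ih hkn⟩

theorem const (n : ℕ) : ∀ {c : ℝ}, 0 ≤ c → AltMono n fun _ => c := by
  induction n with
  | zero => exact fun hc _ _ => hc
  | succ n ih =>
    exact fun {c} hc => ⟨fun _ _ => hc, fun _ => 0,
      fun x _ => by simpa using hasDerivAt_const x c, ih le_rfl⟩

theorem add {n : ℕ} : ∀ {f g : ℝ → ℝ}, AltMono n f → AltMono n g →
    AltMono n fun x => f x + g x := by
  induction n with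
  | zero => exact fun hf hg x hx => add_nonneg (hf x hx) (hg x hx)
  | succ n ih =>
    rintro f g ⟨hf, f', hf', hfn⟩ ⟨hg, g', hg', hgn⟩
    refine ⟨fun x hx => add_nonneg (hf x hx) (hg x hx), _, fun x hx => ?_, ih hfn hgn⟩
    exact ((hf' x hx).add (hg' x hx)).congr_deriv (by ring)

theorem mul {n : ℕ} : ∀ {f g : ℝ → ℝ}, AltMono n f → AltMono n g →
    AltMono n fun x => f x * g x := by
  induction n with
  | zero => exact fun hf hg x hx => mul_nonneg (hf x hx) (hg x hx)
  | succ n ih =>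
    intro f g hf hg
    have hf0 := hf.of_succ
    have hg0 := hg.of_succ
    obtain ⟨hf, f', hf', hfn⟩ := hf
    obtain ⟨hg, g', hg', hgn⟩ := hg
    refine ⟨fun x hx => mul_nonneg (hf x hx) (hg x hx), _, fun x hx => ?_,
      (ih hfn hg0).add (ih hf0 hgn)⟩
    exact ((hf' x hx).mul (hg' x hx)).congr_deriv (by ring)

/-- Composition with a function whose derivative is alternating to one order less. -/
theorem comp {g g' : ℝ → ℝ} (hpos : ∀ x : ℝ, 0 < x → 0 < g x)
    (hg : ∀ x : ℝ, 0 < x → HasDerivAt g (g' x) x) {n : ℕ} :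
    ∀ {f : ℝ → ℝ}, AltMono (n + 1) f → AltMono n g' → AltMono (n + 1) fun x => f (g x) := by
  induction n with
  | zero =>
    rintro f ⟨hf, f', hf', hfn⟩ hgn
    refine ⟨fun x hx => hf _ (hpos x hx), fun x => f' (g x) * g' x, fun x hx => ?_,
      fun x hx => mul_nonneg (hfn _ (hpos x hx)) (hgn x hx)⟩
    exact ((hf' _ (hpos x hx)).comp x (hg x hx)).congr_deriv (by ring)
  | succ n ih =>
    rintro f ⟨hf, f', hf', hfn⟩ hgn
    refine ⟨fun x hx => hf _ (hpos x hx), fun x => f' (g x) * g' x, fun x hx => ?_,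
      (ih hfn hgn.of_succ).mul hgn⟩
    exact ((hf' _ (hpos x hx)).comp x (hg x hx)).congr_deriv (by ring)

/-- The bound `m < n` is strict because the `n`-th derivative is only known to exist, not to be
continuous. -/
theorem contDiffOn_and_iteratedDeriv {n : ℕ} : ∀ {f : ℝ → ℝ}, AltMono n f →
    (∀ m < n, ContDiffOn ℝ m f (Ioi 0)) ∧
      ∀ x : ℝ, 0 < x → 0 ≤ (-1 : ℝ) ^ n * iteratedDeriv n f x := by
  induction n with
  | zero => exact fun h => ⟨fun m hm => absurd hm (Nat.not_lt_zero m), fun x hx => by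
      simpa using h.nonneg hx⟩
  | succ n ih =>
    rintro f ⟨-, g, hg, hgn⟩
    have hd : ∀ x : ℝ, 0 < x → -deriv f x = g x := fun x hx => by rw [(hg x hx).deriv, neg_neg]
    obtain ⟨hc, hi⟩ := ih (hgn.congr hd)
    have hdiff : DifferentiableOn ℝ f (Ioi 0) :=
      fun x hx => (hg x hx).differentiableAt.differentiableWithinAt
    refine ⟨fun m hm => ?_, fun x hx => ?_⟩
    · cases m with
      | zero => exact contDiffOn_zero.2 hdiff.continuousOn
      | succ m =>
        push_cast
        refine (contDiffOn_succ_iff_deriv_of_isOpen isOpen_Ioi).2 ⟨hdiff, by simp, ?_⟩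
        simpa using (hc m (by omega)).neg
    · have h := hi x hx
      rw [iteratedDeriv_fun_neg] at h
      rw [iteratedDeriv_succ', pow_succ]
      linarith

end AltMono

/-! ### Complete monotonicity and Bernstein functions. -/

namespace AltMonoAll

theorem isCompletelyMonotonic {f : ℝ → ℝ} (h : AltMonoAll f) : IsCompletelyMonotonic f :=
  ⟨contDiffOn_infty.2 fun m => (h (m + 1)).contDiffOn_and_iteratedDeriv.1 m m.lt_succ_self,
    fun n => (h n).contDiffOn_and_iteratedDeriv.2⟩

theorem congr {f g : ℝ → ℝ} (h : AltMonoAll f) (e : ∀ x : ℝ, 0 < x → g x = f x) :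
    AltMonoAll g := fun n => (h n).congr e

theorem const {c : ℝ} (hc : 0 ≤ c) : AltMonoAll fun _ => c := fun n => AltMono.const n hc

theorem add {f g : ℝ → ℝ} (hf : AltMonoAll f) (hg : AltMonoAll g) :
    AltMonoAll fun x => f x + g x := fun n => (hf n).add (hg n)

theorem mul {f g : ℝ → ℝ} (hf : AltMonoAll f) (hg : AltMonoAll g) :
    AltMonoAll fun x => f x * g x := fun n => (hf n).mul (hg n)

theorem const_mul {f : ℝ → ℝ} {c : ℝ} (hc : 0 ≤ c) (hf : AltMonoAll f) :
    AltMonoAll fun x => c * f x := (const hc).mul hf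

theorem comp {f g g' : ℝ → ℝ} (hf : AltMonoAll f) (hg : IsBernstein g g') :
    AltMonoAll fun x => f (g x) :=
  fun n => ((hf (n + 1)).comp hg.pos hg.hasDerivAt (hg.altMono n)).of_succ

/-- A nonnegative function with completely monotonic negative derivative. -/
theorem of_deriv {f g : ℝ → ℝ} (h0 : ∀ x : ℝ, 0 < x → 0 ≤ f x)
    (hf : ∀ x : ℝ, 0 < x → HasDerivAt f (-g x) x) (hg : AltMonoAll g) : AltMonoAll f := by
  rintro (_ | n)
  · exact h0
  · exact ⟨h0, g, hf, hg n⟩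

/-- A nonnegative function whose negative logarithmic derivative `ψ` is as alternating as
`f` itself. -/
theorem of_logDeriv_of_imp {f ψ : ℝ → ℝ} (h0 : ∀ x : ℝ, 0 < x → 0 ≤ f x)
    (hf : ∀ x : ℝ, 0 < x → HasDerivAt f (-(f x * ψ x)) x)
    (hψ : ∀ n, AltMono n f → AltMono n ψ) : AltMonoAll f := by
  intro n
  induction n with
  | zero => exact h0
  | succ n ih => exact ⟨h0, _, hf, ih.mul (hψ n ih)⟩

theorem of_logDeriv {f ψ : ℝ → ℝ} (h0 : ∀ x : ℝ, 0 < x → 0 ≤ f x)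
    (hf : ∀ x : ℝ, 0 < x → HasDerivAt f (-(f x * ψ x)) x) (hψ : AltMonoAll ψ) : AltMonoAll f :=
  of_logDeriv_of_imp h0 hf fun n _ => hψ n

theorem inv_add {a : ℝ} (ha : 0 ≤ a) : AltMonoAll fun x => (a + x)⁻¹ := by
  -- The function is its own negative logarithmic derivative, so the induction feeds itself.
  refine of_logDeriv_of_imp (ψ := fun x => (a + x)⁻¹)
    (fun x hx => by positivity) (fun x hx => ?_) fun n h => h
  have h : a + x ≠ 0 := by positivity
  exact (((hasDerivAt_id x).const_add a).inv h).congr_deriv (by simp; field_simp)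

theorem inv : AltMonoAll fun x => x⁻¹ := (inv_add le_rfl).congr fun x _ => by rw [zero_add]

theorem exp_neg : AltMonoAll fun x => Real.exp (-x) :=
  of_logDeriv (ψ := fun _ => 1) (fun x _ => (Real.exp_pos _).le)
    (fun x _ => ((hasDerivAt_id x).neg.exp).congr_deriv (by simp)) (const zero_le_one)

end AltMonoAll

/-- A solution of the autonomous equation `g' = φ(g)`, with `φ` completely monotonic. -/
theorem IsBernstein.of_ode {g φ : ℝ → ℝ} (hpos : ∀ x : ℝ, 0 < x → 0 < g x)
    (hg : ∀ x : ℝ, 0 < x → HasDerivAt g (φ (g x)) x) (hφ : AltMonoAll φ) :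
    IsBernstein g fun x => φ (g x) := by
  refine ⟨hpos, hg, fun n => ?_⟩
  induction n with
  | zero => exact fun x hx => hφ 0 _ (hpos x hx)
  -- `g' = φ ∘ g`, so order `n` of `g'` yields order `n + 1` of `φ ∘ g`, which is `g'` again.
  | succ n ih => exact (hφ (n + 1)).comp hpos hg ih

/-! ### The elementary functions `exp(c/v) v^a (1+v)^d`. -/

theorem hasDerivAt_exp_div_mul_rpow (c a d : ℝ) {x : ℝ} (hx : 0 < x) :
    HasDerivAt (fun v : ℝ => Real.exp (c / v) * v ^ a * (1 + v) ^ d)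
      (-(Real.exp (c / x) * x ^ a * (1 + x) ^ d * (c * (x⁻¹ * x⁻¹) - a * x⁻¹ - d * (1 + x)⁻¹)))
      x := by
  have hx1 : 0 < 1 + x := by linarith
  have h1 := ((hasDerivAt_inv hx.ne').const_mul c).exp
  have h2 := Real.hasDerivAt_rpow_const (x := x) (p := a) (Or.inl hx.ne')
  have h3 := ((hasDerivAt_id x).const_add 1).rpow_const (p := d) (Or.inl hx1.ne')
  refine ((h1.mul h2).mul h3).congr_deriv ?_
  simp only [id, Pi.mul_apply, ← div_eq_mul_inv, Real.rpow_sub_one hx.ne',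
    Real.rpow_sub_one hx1.ne']
  field_simp
  ring

theorem AltMonoAll.exp_div_mul_rpow {c a d : ℝ}
    (h : AltMonoAll fun x => c * (x⁻¹ * x⁻¹) - a * x⁻¹ - d * (1 + x)⁻¹) :
    AltMonoAll fun v => Real.exp (c / v) * v ^ a * (1 + v) ^ d :=
  .of_logDeriv (fun x hx => by positivity) (fun _ hx => hasDerivAt_exp_div_mul_rpow c a d hx) h

/-- The elementary case: all three factors are completely monotonic. -/
theorem AltMonoAll.exp_div_mul_rpow_of_nonpos {c a d : ℝ} (hc : 0 ≤ c) (ha : a ≤ 0) (hd : d ≤ 0) :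
    AltMonoAll fun v => Real.exp (c / v) * v ^ a * (1 + v) ^ d := by
  refine .exp_div_mul_rpow (.congr (((inv.mul inv).const_mul hc).add
    ((inv.const_mul (neg_nonneg.2 ha)).add ((inv_add zero_le_one).const_mul (neg_nonneg.2 hd))))
    fun x _ => ?_)
  ring

/-- A growing power of `v`, compensated by the exponential factor and by `(1 + v) ^ d`. -/
theorem AltMonoAll.exp_div_mul_rpow_of_le {c a d : ℝ} (ha : 0 ≤ a) (hc : a ≤ c) (hd : d ≤ -a) :
    AltMonoAll fun v => Real.exp (c / v) * v ^ a * (1 + v) ^ d := by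
  have h1 : AltMonoAll fun x => (1 + x)⁻¹ := inv_add zero_le_one
  -- Since `1/x² - 1/x + 1/(1+x) = 1/(x²(1+x))`, the negative logarithmic derivative is `a/(x²(1+x))
  -- + (c-a)/x² + (-a-d)/(1+x)`.
  refine .exp_div_mul_rpow (.congr ((((inv.mul inv).mul h1).const_mul ha).add
    (((inv.mul inv).const_mul (sub_nonneg.2 hc)).add (h1.const_mul (sub_nonneg.2 hd))))
    fun x hx => ?_)
  have : 1 + x ≠ 0 := by positivity
  field_simp
  ring

theorem AltMonoAll.rpow {a : ℝ} (ha : a ≤ 0) : AltMonoAll fun x => x ^ a :=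
  (exp_div_mul_rpow_of_nonpos (c := 0) (d := 0) le_rfl ha le_rfl).congr fun x _ => by simp

theorem AltMonoAll.one_add_rpow {a : ℝ} (ha : a ≤ 0) : AltMonoAll fun x => (1 + x) ^ a :=
  (exp_div_mul_rpow_of_nonpos (c := 0) (a := 0) le_rfl le_rfl ha).congr fun x _ => by simp

theorem isBernstein_rpow {b : ℝ} (h0 : 0 ≤ b) (h1 : b ≤ 1) :
    IsBernstein (fun x => x ^ b) fun x => b * x ^ (b - 1) :=
  ⟨fun _ hx => Real.rpow_pos_of_pos hx b,
    fun _ hx => Real.hasDerivAt_rpow_const (Or.inl hx.ne'),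
    (AltMonoAll.rpow (by linarith)).const_mul h0⟩

/-! ### The differential equations of `W` and `V`. -/

theorem lambertW_mul_exp_lambertW {x : ℝ} (hx : 0 < x) :
    lambertW x * Real.exp (lambertW x) = x :=
  (lambertW_spec (by linarith [Real.exp_pos (-1)])).2

theorem hasDerivAt_lambertW {x : ℝ} (hx : 0 < x) :
    HasDerivAt lambertW (Real.exp (-lambertW x) * (1 + lambertW x)⁻¹) x := by
  have hw := lambertW_pos hx
  have hs : HasStrictDerivAt (fun w : ℝ => w * Real.exp w)
      (1 * Real.exp (lambertW x) + lambertW x * Real.exp (lambertW x)) (lambertW x) :=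
    (hasStrictDerivAt_id _).mul (Real.hasStrictDerivAt_exp _)
  have hl : ∀ᶠ w in nhds (lambertW x), lambertW (w * Real.exp w) = w :=
    Filter.eventually_of_mem (Ioi_mem_nhds hw) fun w hw =>
      lambertW_mul_exp (by linarith [mem_Ioi.1 hw])
  have h := (hs.to_local_left_inverse (by positivity) hl).hasDerivAt
  rw [lambertW_mul_exp_lambertW hx] at h
  refine h.congr_deriv ?_
  rw [Real.exp_neg, ← mul_inv, mul_one_add, mul_comm _ (lambertW x),
    lambertW_mul_exp_lambertW hx, one_mul]

theorem isBernstein_lambertW :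
    IsBernstein lambertW fun x => Real.exp (-lambertW x) * (1 + lambertW x)⁻¹ :=
  .of_ode (φ := fun w => Real.exp (-w) * (1 + w)⁻¹) (fun _ => lambertW_pos)
    (fun _ => hasDerivAt_lambertW) (AltMonoAll.exp_neg.mul (.inv_add zero_le_one))

/-- The reciprocal of `W(1/x)`, a Bernstein function. -/
noncomputable def invLambertWInv (x : ℝ) : ℝ := (lambertW x⁻¹)⁻¹

theorem invLambertWInv_pos {x : ℝ} (hx : 0 < x) : 0 < invLambertWInv x :=
  inv_pos.2 (lambertW_pos (inv_pos.2 hx))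

theorem hasDerivAt_invLambertWInv {x : ℝ} (hx : 0 < x) :
    HasDerivAt invLambertWInv (Real.exp (1 / invLambertWInv x) * invLambertWInv x ^ (1 : ℝ) *
      (1 + invLambertWInv x) ^ (-1 : ℝ)) x := by
  have hxi := inv_pos.2 hx
  have hw := lambertW_pos hxi
  have he := lambertW_mul_exp_lambertW hxi
  refine (((hasDerivAt_lambertW hxi).comp x (hasDerivAt_inv hx.ne')).inv hw.ne').congr_deriv ?_
  -- Eliminating `x` in favour of `W(1/x)` makes the equation autonomous.
  have hx2 : (x ^ 2)⁻¹ = (lambertW x⁻¹ * Real.exp (lambertW x⁻¹)) ^ 2 := by rw [he, inv_pow]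
  simp only [invLambertWInv, Function.comp_apply, hx2, Real.rpow_one, Real.rpow_neg_one, one_div,
    inv_inv, Real.exp_neg]
  have := Real.exp_pos (lambertW x⁻¹)
  generalize lambertW x⁻¹ = w at *
  field_simp
  ring

theorem isBernstein_invLambertWInv :
    IsBernstein invLambertWInv fun x => Real.exp (1 / invLambertWInv x) *
      invLambertWInv x ^ (1 : ℝ) * (1 + invLambertWInv x) ^ (-1 : ℝ) :=
  .of_ode (φ := fun v => Real.exp (1 / v) * v ^ (1 : ℝ) * (1 + v) ^ (-1 : ℝ))
    (fun _ => invLambertWInv_pos) (fun _ => hasDerivAt_invLambertWInv)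
    (.exp_div_mul_rpow_of_le zero_le_one le_rfl le_rfl)

theorem lambertW_inv_rpow_mul {x : ℝ} (hx : 0 < x) (a c : ℝ) :
    lambertW x⁻¹ ^ a * (1 + lambertW x⁻¹) ^ c =
      invLambertWInv x ^ (-a - c) * (1 + invLambertWInv x) ^ c := by
  have hv := invLambertWInv_pos hx
  have hw : lambertW x⁻¹ = (invLambertWInv x)⁻¹ := (inv_inv _).symm
  have h1 : 1 + (invLambertWInv x)⁻¹ = (1 + invLambertWInv x) / invLambertWInv x := by
    field_simp
    ring
  rw [hw, h1, Real.div_rpow (by positivity) hv.le, Real.inv_rpow hv.le, Real.rpow_sub hv,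
    Real.rpow_neg hv.le]
  ring

theorem rpow_eq_inv_rpow_neg {x : ℝ} (hx : 0 < x) (β : ℝ) : x ^ β = (x ^ (-β))⁻¹ := by
  rw [Real.rpow_neg hx.le, inv_inv]

/-! ### The four families. -/

/-- `W = x exp(-W)` turns the function into `x^(l+1) exp(-W)`, whence the threshold `l ≤ -1`. -/
theorem altMonoAll_rpow_mul_lambertW {l : ℝ} (hl : l ≤ -1) :
    AltMonoAll fun x => x ^ l * lambertW x := by
  refine ((AltMonoAll.rpow (a := l + 1) (by linarith)).mul
    (AltMonoAll.exp_neg.comp isBernstein_lambertW)).congr fun x hx => ?_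
  have h := lambertW_mul_exp_lambertW hx
  have h' : x * Real.exp (-lambertW x) = lambertW x := by
    rw [Real.exp_neg, ← div_eq_mul_inv, div_eq_iff (Real.exp_pos _).ne', h]
  rw [Real.rpow_add_one hx.ne', mul_assoc, h']

theorem altMonoAll_lambertW_inv_rpow_mul {α γ : ℝ} (hα : 0 ≤ α) (hγ : 0 ≤ γ) :
    AltMonoAll fun x => lambertW x⁻¹ ^ α * (1 + lambertW x⁻¹) ^ γ := by
  -- The second factor is `(1 + 1/v)^γ`, with negative logarithmic derivative `γ/(v(1+v))`;
  -- `exp(0/v) = 1` only fits it to the general form.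
  have hφ : AltMonoAll fun v => v ^ (-α) * (Real.exp (0 / v) * v ^ (-γ) * (1 + v) ^ γ) := by
    refine (AltMonoAll.rpow (neg_nonpos.2 hα)).mul (.exp_div_mul_rpow
      (((AltMonoAll.inv.mul (.inv_add zero_le_one)).const_mul hγ).congr fun x hx => ?_))
    have : 1 + x ≠ 0 := by positivity
    field_simp
    ring
  refine (hφ.comp isBernstein_invLambertWInv).congr fun x hx => ?_
  rw [lambertW_inv_rpow_mul hx, sub_eq_add_neg, Real.rpow_add (invLambertWInv_pos hx), zero_div,
    Real.exp_zero]
  ring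

theorem altMonoAll_lambertW_rpow_mul {α γ : ℝ} (hα : α ≤ 0) (hγ : γ ≤ 0) :
    AltMonoAll fun x => lambertW x ^ α * (1 + lambertW x) ^ γ :=
  ((AltMonoAll.rpow hα).mul (.one_add_rpow hγ)).comp isBernstein_lambertW

/-- The last family in the variable `y = x ^ (-β)`. As `y W(1/y) = exp(-1/V)`, it equals `1 -
exp(-αγ/V) V^(1-γ) (1+V)^(γ-1)`. -/
theorem altMonoAll_one_sub_lambertW_inv {α γ : ℝ} (hα : 0 ≤ α) (hα1 : α ≤ 1) (hγ : 0 ≤ γ)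
    (hγ1 : γ ≤ 1) :
    AltMonoAll fun y =>
      1 - y ^ (α * γ) * lambertW y⁻¹ ^ (α * γ) * (1 + lambertW y⁻¹) ^ (γ - 1) := by
  have hαγ : 0 ≤ α * γ := mul_nonneg hα hγ
  have hαγ' : α * γ ≤ γ := mul_le_of_le_one_left hγ hα1
  have e : ∀ y : ℝ, 0 < y →
      1 - y ^ (α * γ) * lambertW y⁻¹ ^ (α * γ) * (1 + lambertW y⁻¹) ^ (γ - 1) =
      1 - Real.exp (-(α * γ) / invLambertWInv y) * invLambertWInv y ^ (1 - γ) *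
        (1 + invLambertWInv y) ^ (γ - 1) := by
    intro y hy
    have hw := lambertW_pos (inv_pos.2 hy)
    have h2 := lambertW_inv_rpow_mul hy 0 (γ - 1)
    rw [Real.rpow_zero, one_mul] at h2
    have h1 : y * lambertW y⁻¹ = Real.exp (-lambertW y⁻¹) := by
      have h := lambertW_mul_exp_lambertW (inv_pos.2 hy)
      rw [Real.exp_neg, ← mul_eq_one_iff_eq_inv₀ (Real.exp_pos _).ne', mul_assoc, h,
        mul_inv_cancel₀ hy.ne']
    rw [← Real.mul_rpow hy.le hw.le, h1, ← Real.exp_mul, h2, mul_assoc]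
    congr 3
    · simp only [invLambertWInv, div_inv_eq_mul]
      ring
    · congr 1
      ring
  -- This is minus the `y`-derivative, written in `v = V(y)`: the negative logarithmic derivative of
  -- the subtracted product contributes `-(αγ/v² + (1-γ)/(v(1+v)))` with sign reversed, and the
  -- equation of `V` supplies `exp(1/v) v/(1+v)`. The second summand needs `1 - γ ≤ 1 - αγ`, that is
  -- `α ≤ 1`.
  have hφ : AltMonoAll fun v =>
      α * γ * (Real.exp ((1 - α * γ) / v) * v ^ (-γ) * (1 + v) ^ (γ - 2)) +
      (1 - γ) * (Real.exp ((1 - α * γ) / v) * v ^ (1 - γ) * (1 + v) ^ (γ - 3)) :=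
    ((AltMonoAll.exp_div_mul_rpow_of_nonpos (by linarith) (by linarith) (by linarith)).const_mul
      hαγ).add ((AltMonoAll.exp_div_mul_rpow_of_le (by linarith) (by linarith)
        (by linarith)).const_mul (by linarith))
  refine AltMonoAll.congr (.of_deriv (fun y hy => ?_) (fun y hy => ?_)
    (hφ.comp isBernstein_invLambertWInv)) e
  · rw [← e y hy, sub_nonneg]
    have hw := lambertW_pos (inv_pos.2 hy)
    rw [← Real.mul_rpow hy.le hw.le]
    have h1 : y * lambertW y⁻¹ ≤ 1 := by
      have h := lambertW_mul_exp_lambertW (inv_pos.2 hy)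
      have : lambertW y⁻¹ ≤ y⁻¹ :=
        (le_mul_of_one_le_right hw.le (Real.one_le_exp hw.le)).trans_eq h
      calc y * lambertW y⁻¹ ≤ y * y⁻¹ := by gcongr
        _ = 1 := mul_inv_cancel₀ hy.ne'
    exact mul_le_one₀ (Real.rpow_le_one (by positivity) h1 hαγ) (by positivity)
      (Real.rpow_le_one_of_one_le_of_nonpos (by linarith) (by linarith))
  · have hv := invLambertWInv_pos hy
    refine (((hasDerivAt_exp_div_mul_rpow (-(α * γ)) (1 - γ) (γ - 1) hv).comp y
      (hasDerivAt_invLambertWInv hy)).const_sub 1).congr_deriv ?_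
    generalize invLambertWInv y = v at hv
    have hv1 : 0 < 1 + v := by linarith
    have e1 : (1 - α * γ) / v = 1 / v + -(α * γ) / v := by ring
    have e2 : v ^ (-γ) = v ^ (1 - γ) / v := by
      rw [← Real.rpow_sub_one hv.ne']
      congr 1
      ring
    have e3 : (1 + v) ^ (γ - 2) = (1 + v) ^ (γ - 1) / (1 + v) := by
      rw [← Real.rpow_sub_one hv1.ne']
      congr 1
      ring
    have e4 : (1 + v) ^ (γ - 3) = (1 + v) ^ (γ - 1) / (1 + v) / (1 + v) := by
      rw [← Real.rpow_sub_one hv1.ne', ← Real.rpow_sub_one hv1.ne']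
      congr 1
      ring
    rw [e1, Real.exp_add, e2, e3, e4, Real.rpow_one, Real.rpow_neg_one]
    field_simp
    ring

theorem mainTheorem8 :
    (∀ l : ℝ, l ≤ -1 →
      IsCompletelyMonotonic fun x : ℝ => x ^ l * lambertW x) ∧
    (∀ l α β γ : ℝ, 0 ≤ α → 0 ≤ γ → -1 ≤ β → β ≤ 0 → l ≤ 0 →
      IsCompletelyMonotonic fun x : ℝ =>
        x ^ l * lambertW (x ^ β) ^ α * (1 + lambertW (x ^ β)) ^ γ) ∧
    (∀ l α β γ : ℝ, α ≤ 0 → γ ≤ 0 → -1 ≤ β → β ≤ 0 → l ≤ 0 →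
      IsCompletelyMonotonic fun x : ℝ =>
        x ^ l * lambertW (x ^ (-β)) ^ α * (1 + lambertW (x ^ (-β))) ^ γ) ∧
    (∀ α β γ : ℝ, 0 ≤ α → α ≤ 1 → -1 ≤ β → β ≤ 0 → 0 ≤ γ → γ ≤ 1 →
      IsCompletelyMonotonic fun x : ℝ =>
        1 - x ^ (-(α * β * γ)) * lambertW (x ^ β) ^ (α * γ) *
          (1 + lambertW (x ^ β)) ^ (γ - 1)) := by
  refine ⟨fun l hl => (altMonoAll_rpow_mul_lambertW hl).isCompletelyMonotonic,
    fun l α β γ hα hγ hβ hβ0 hl => AltMonoAll.isCompletelyMonotonic ?_,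
    fun l α β γ hα hγ hβ hβ0 hl => AltMonoAll.isCompletelyMonotonic ?_,
    fun α β γ hα hα1 hβ hβ0 hγ hγ1 => AltMonoAll.isCompletelyMonotonic ?_⟩
  · refine ((AltMonoAll.rpow hl).mul ((altMonoAll_lambertW_inv_rpow_mul hα hγ).comp
      (isBernstein_rpow (b := -β) (by linarith) (by linarith)))).congr fun x hx => ?_
    rw [rpow_eq_inv_rpow_neg hx β, mul_assoc]
  · refine ((AltMonoAll.rpow hl).mul ((altMonoAll_lambertW_rpow_mul hα hγ).comp
      (isBernstein_rpow (b := -β) (by linarith) (by linarith)))).congr fun x hx => ?_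
    rw [mul_assoc]
  · refine ((altMonoAll_one_sub_lambertW_inv hα hα1 hγ hγ1).comp
      (isBernstein_rpow (b := -β) (by linarith) (by linarith))).congr fun x hx => ?_
    rw [rpow_eq_inv_rpow_neg hx β, ← Real.rpow_mul hx.le, neg_mul, mul_right_comm α,
      mul_comm β]
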